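/- Let $\mathcal C$ be a triangulated category (in the sense of Verdier, so including the octahedral axiom; $\mathcal C$ is not assumed to be idempotent complete). Let $(M,\mu,\eta)$ be an exact monad on $\mathcal C$: $M:\mathcal C\to\mathcal C$ is an exact functor, with given shift isomorphisms $M(X[n])\cong (MX)[n]$, and the natural transformations $\mu:M^2\to M$ and $\eta:\mathrm{id}_{\mathcal C}\to M$ commute with the shift. Assume that $M$ is stably separable: there is a natural transformation $\sigma:M\to M^2$, commuting with the shift, such that $$\mu\circ\sigma=\mathrm{id}_M\qquad\text{and}\qquad M\mu\circ\sigma M=\sigma\circ\mu=\mu M\circ M\sigma .$$ Then the Eilenberg–Moore category $M\text{-}\mathrm{Mod}$ of $M$-modules, with its additive structure inherited from $\mathcal C$, carries the structure of a triangulated category (a shift and a class of distinguished triangles satisfying all of Verdier's axioms, including the octahedral axiom) for which the free module functor $F_M:\mathcal C\to M\text{-}\mathrm{Mod}$ and the forgetful functor $G_M:M\text{-}\mathrm{Mod}\to\mathcal C$ are exact. Moreover the shift and the shift isomorphisms of $F_M$ and $G_M$ can be chosen such that the unit and the counit of the adjunction $F_M\dashv G_M$ commute with the shift and such that the identity $G_M\circ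 F_M=M$ is compatible with the shift isomorphisms. -/

import Mathlib

open CategoryTheory Category Limits Pretriangulated

universe v u

namespace CategoryTheory.Monad

/-- The identification `G_M ∘ F_M = M`, where `F_M = T.free : C ⥤ T.Algebra` and
`G_M = T.forget : T.Algebra ⥤ C` are the free and the forgetful functor of the Eilenberg-Moore
category of the monad `M = T`. All its components are identities. -/
def freeCompForget {C : Type u} [Category.{v} C] (T : Monad C) :
    T.free ⋙ T.forget ≅ T.toFunctor :=
  NatIso.ofComponents (fun _ => Iso.refl _) (by
    intro X Y f
    exact (comp_id _).trans (id_comp _).symm)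

/-- A natural transformation `σ : M ⟶ M²` is a *separating section* of the monad `(M, μ, η)` if
`μ ∘ σ = id` and `Mμ ∘ σM = σ ∘ μ = μM ∘ Mσ`. -/
structure IsSeparatingSection {C : Type u} [Category.{v} C] (T : Monad C)
    (σ : T.toFunctor ⟶ T.toFunctor ⋙ T.toFunctor) : Prop where
  section_mul : σ ≫ T.μ = 𝟙 T.toFunctor
  left_linear : ∀ X : C,
    σ.app (T.obj X) ≫ T.map (T.μ.app X) = T.μ.app X ≫ σ.app X
  right_linear : ∀ X : C,
    T.map (σ.app X) ≫ T.μ.app (T.obj X) = T.μ.app X ≫ σ.app X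

/-- On a category with shift, a monad `(M, μ, η)` whose underlying functor comes with isomorphisms
`M(X⟦n⟧) ≅ (M X)⟦n⟧` is *stable* if the natural transformations `η` and `μ` commute with the
shift. -/
class IsStable {C : Type u} [Category.{v} C] [HasShift C ℤ] (T : Monad C)
    [T.toFunctor.CommShift ℤ] : Prop where
  commShift_η : NatTrans.CommShift T.η ℤ
  commShift_μ : NatTrans.CommShift T.μ ℤ

/-- A monad `(M, μ, η)` on a category with shift is *stably separable* if it is stable and if `μ`
has a separating section `σ : M ⟶ M²` which commutes with the shift. -/
class IsStablySeparable {C : Type u} [Category.{v} C] [HasShift C ℤ] (T : Monad C)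
    [T.toFunctor.CommShift ℤ] : Prop extends T.IsStable where
  exists_section : ∃ σ : T.toFunctor ⟶ T.toFunctor ⋙ T.toFunctor,
    T.IsSeparatingSection σ ∧ NatTrans.CommShift σ ℤ

end CategoryTheory.Monad

/-! Separability gives each module `X` a linear section `sec` of its action, natural in `X`.
Averaging `φ` to `sec ≫ Mφ ≫ a` retracts maps in `C` between underlying objects onto module maps.
This respects composition with module maps on either side, but not composition of arbitrary maps. A
triangle of modules is declared distinguished when its image in `C` is; fill-ins of morphisms of
triangles then exist by averaging those in `C`. Two points remain.

Cones: the cone `Z` in `C` of a module map carries fill-ins `w : Z ⟶ MZ` and `p₀ : MZ ⟶ Z`, but `p₀`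
need not be an action. The linear extension of `w` to `MZ` is idempotent up to a square-zero error,
so `3e² - 2e³` turns it into a linear idempotent. Corrected versions of `w` and `p₀` split it
through `Z` itself, which makes `Z` a module without any idempotent completeness (`exists_retract`,
`exists_cone`).

Octahedra: averaging the two new maps of an octahedron separately may destroy the triangle they
form. The homotopy cartesian form of the axiom asks for a single new map; after averaging, a diagram
chase shows that its triangle is distinguished. -/

namespace CategoryTheory

/-! ### Exactness on generalized elements. -/

section FiveLemma

/-- A morphism which is injective and surjective on generalized elements is an isomorphism. -/
lemma isIso_of_forall_precomp {C : Type*} [Category* C] [Preadditive C] {X Y : C} (α : X ⟶ Y)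
    (inj : ∀ {K : C} (x : K ⟶ X), x ≫ α = 0 → x = 0)
    (surj : ∀ {K : C} (y : K ⟶ Y), ∃ x : K ⟶ X, x ≫ α = y) : IsIso α := by
  obtain ⟨s, hs⟩ := surj (𝟙 Y)
  refine ⟨s, ?_, hs⟩
  rw [← sub_eq_zero]
  apply inj
  rw [Preadditive.sub_comp, assoc, hs, comp_id, id_comp, sub_self]

variable {C : Type*} [Category* C] [HasZeroObject C] [HasShift C ℤ] [Preadditive C]
  [∀ n : ℤ, (shiftFunctor C n).Additive] [Pretriangulated C]

namespace Pretriangulated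

section

variable {X Y Z : C} {f : X ⟶ Y} {g : Y ⟶ Z} {h : Z ⟶ X⟦(1 : ℤ)⟧}
  (hT : Triangle.mk f g h ∈ distTriang C) {K : C}

include hT

lemma exists_comp_eq_of_comp_mor₂ (y : K ⟶ Y) (hy : y ≫ g = 0) : ∃ x : K ⟶ X, x ≫ f = y :=
  (Triangle.coyoneda_exact₂ _ hT y hy).imp fun _ => Eq.symm

lemma exists_comp_eq_of_comp_mor₃ (z : K ⟶ Z) (hz : z ≫ h = 0) : ∃ y : K ⟶ Y, y ≫ g = z :=
  (Triangle.coyoneda_exact₃ _ hT z hz).imp fun _ => Eq.symm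

lemma exists_comp_eq_of_comp_shift_mor₁ (x : K ⟶ X⟦(1 : ℤ)⟧) (hx : x ≫ f⟦1⟧' = 0) :
    ∃ z : K ⟶ Z, z ≫ h = x :=
  (Triangle.coyoneda_exact₁ _ hT x hx).imp fun _ => Eq.symm

lemma exists_comp_eq_of_comp_shift_mor₂ (y : K ⟶ Y⟦(1 : ℤ)⟧) (hy : y ≫ g⟦1⟧' = 0) :
    ∃ x : K ⟶ X⟦(1 : ℤ)⟧, x ≫ f⟦1⟧' = y := by
  obtain ⟨x, hx⟩ : ∃ x : K ⟶ X⟦(1 : ℤ)⟧, x ≫ (-f⟦1⟧') = y :=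
    exists_comp_eq_of_comp_shift_mor₁ (rot_of_distTriang _ hT) y hy
  exact ⟨-x, by rw [← hx, Preadditive.neg_comp, Preadditive.comp_neg]⟩

lemma exists_fill {X' Y' Z' : C} {f' : X' ⟶ Y'} {g' : Y' ⟶ Z'} {h' : Z' ⟶ X'⟦(1 : ℤ)⟧}
    (hT' : Triangle.mk f' g' h' ∈ distTriang C) (a : X ⟶ X') (b : Y ⟶ Y')
    (comm : f ≫ b = a ≫ f') : ∃ c : Z ⟶ Z', g ≫ c = b ≫ g' ∧ h ≫ a⟦1⟧' = c ≫ h' :=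
  complete_distinguished_triangle_morphism _ _ hT hT' a b comm

end

/-- A triangle `(a, b, c)` such that `K ⟶ X ⟶ Y ⟶ Z ⟶ X⟦1⟧` is exact at `Y` and at `Z` for all
generalized elements is distinguished as soon as it receives a morphism, which is the identity on
`X` and `Y`, from a distinguished triangle. -/
lemma distinguished_of_exact {X Y Z W : C}
    {a : X ⟶ Y} {j : Y ⟶ W} {d : W ⟶ X⟦(1 : ℤ)⟧} (hT : Triangle.mk a j d ∈ distTriang C)
    {b : Y ⟶ Z} {c : Z ⟶ X⟦(1 : ℤ)⟧} (α : W ⟶ Z) (hb : j ≫ α = b) (hc : α ≫ c = d)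
    (exact₂ : ∀ {K : C} (y : K ⟶ Y), y ≫ b = 0 → ∃ x : K ⟶ X, x ≫ a = y)
    (exact₃ : ∀ {K : C} (z : K ⟶ Z), z ≫ c = 0 → ∃ y : K ⟶ Y, y ≫ b = z)
    (zero : c ≫ a⟦1⟧' = 0) : Triangle.mk a b c ∈ distTriang C := by
  have haj : a ≫ j = 0 := comp_distTriang_mor_zero₁₂ _ hT
  -- Injectivity uses exactness at `Y`; surjectivity uses exactness at `Z` and `c ≫ a⟦1⟧' = 0`.
  have : IsIso α := isIso_of_forall_precomp α
    (fun x hx => by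
      obtain ⟨y, hy⟩ := exists_comp_eq_of_comp_mor₃ hT x (by
        rw [← hc, reassoc_of% hx, zero_comp])
      obtain ⟨x', hx'⟩ := exact₂ y (by rw [← hb, ← assoc, hy, hx])
      rw [← hy, ← hx', assoc, haj, comp_zero])
    (fun z => by
      obtain ⟨w, hw⟩ := exists_comp_eq_of_comp_shift_mor₁ hT (z ≫ c) (by
        rw [assoc, zero, comp_zero])
      obtain ⟨y, hy⟩ := exact₃ (z - w ≫ α) (by
        rw [Preadditive.sub_comp, assoc, hc, hw, sub_self])
      refine ⟨w + y ≫ j, ?_⟩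
      rw [Preadditive.add_comp, assoc, hb, hy, add_sub_cancel])
  refine isomorphic_distinguished _ hT _
    (Triangle.isoMk _ _ (Iso.refl _) (Iso.refl _) (asIso α).symm ?_ ?_ ?_)
  · exact (comp_id _).trans (id_comp _).symm
  · change b ≫ inv α = 𝟙 _ ≫ j
    rw [← hb, assoc, IsIso.hom_inv_id, comp_id, id_comp]
  · change c ≫ (𝟙 X)⟦1⟧' = inv α ≫ d
    rw [← hc, IsIso.inv_hom_id_assoc, Functor.map_id, comp_id]

end Pretriangulated

end FiveLemma

/-! ### The octahedral axiom via homotopy cartesian squares. -/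

section HomotopyCartesian

variable (C : Type*) [Category* C] [HasZeroObject C] [HasShift C ℤ] [Preadditive C]
  [∀ n : ℤ, (shiftFunctor C n).Additive] [Pretriangulated C]

/-- A form of the octahedron axiom: the pushforward along `g` of a distinguished triangle on
`f : X ⟶ Y` to a distinguished triangle on `f ≫ g` can be chosen so that the resulting square is
homotopy cartesian, with the expected connecting morphism. -/
def Pretriangulated.HasHomotopyCartesianSquares : Prop :=
  ∀ {X Y Z P Q : C} (f : X ⟶ Y) (g : Y ⟶ Z) (i : Y ⟶ P) (h : P ⟶ X⟦(1 : ℤ)⟧)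
    (_ : Triangle.mk f i h ∈ distTriang C) (i' : Z ⟶ Q) (h' : Q ⟶ X⟦(1 : ℤ)⟧)
    (_ : Triangle.mk (f ≫ g) i' h' ∈ distTriang C),
    ∃ u : P ⟶ Q, i ≫ u = g ≫ i' ∧ u ≫ h' = h ∧
      Triangle.mk (biprod.lift g i) (biprod.desc (-i') u) (-(h' ≫ f⟦1⟧')) ∈ distTriang C

variable {C}

/-- The hypothesis is used twice: for `f` and `g`, giving `u`, and then for `Y ⟶ Z ⊞ P ⟶ Z`, whose
composite is again `g`, giving `v : Q ⟶ R`. The octahedron is `(u, -v)`, the sign coming from `-i'`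
in the homotopy cartesian triangle. -/
lemma Pretriangulated.HasHomotopyCartesianSquares.isTriangulated
    (H : HasHomotopyCartesianSquares C) : IsTriangulated C where
  octahedron_axiom := by
    intro X Y Z P R Q f g k comm i h hf iR hR hg i' h' hfg
    subst comm
    obtain ⟨u, hu₁, hu₂, hu⟩ := H f g i h hf i' h' hfg
    obtain ⟨v, hv₁, hv₂, hv⟩ := H (biprod.lift g i) biprod.fst _ _ hu iR hR (by
      rw [biprod.lift_fst]; exact hg)
    have hv₃ : i' ≫ v = -iR := by
      have := biprod.inl ≫= hv₁
      rw [biprod.inl_desc_assoc, biprod.inl_fst_assoc, Preadditive.neg_comp] at this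
      rw [← this, neg_neg]
    have huv : u ≫ v = 0 := by
      have := biprod.inr ≫= hv₁
      rwa [biprod.inr_desc_assoc, biprod.inr_fst_assoc, zero_comp] at this
    have hRg : hR ≫ g⟦1⟧' = 0 := comp_distTriang_mor_zero₃₁ _ hg
    refine ⟨⟨u, -v, hu₁, hu₂, ?_, ?_, ?_⟩⟩
    · rw [Preadditive.comp_neg, hv₃, neg_neg]
    · rw [Preadditive.neg_comp, hv₂, neg_neg]
    · obtain ⟨S, c, d, hS⟩ := distinguished_cocone_triangle u
      -- The inclusions of the second summands map the cone of `u` to the second homotopy cartesian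
      -- triangle.
      obtain ⟨α, hα₁, hα₂⟩ := exists_fill hS hv biprod.inr biprod.inr (by
          apply biprod.hom_ext <;> simp)
      have hα₃ : d = -(α ≫ hR ≫ i⟦1⟧') := by
        have := hα₂ =≫ biprod.snd⟦1⟧'
        simpa only [Preadditive.comp_neg, Preadditive.neg_comp, assoc, ← Functor.map_comp,
          biprod.inr_snd, biprod.lift_snd, Functor.map_id, comp_id] using this
      refine distinguished_of_exact hS (-α) ?_ ?_ ?_ ?_ ?_
      · rw [Preadditive.comp_neg, hα₁, biprod.inr_desc]
      · rw [hα₃, Preadditive.neg_comp]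
      · intro K q hq
        rw [Preadditive.comp_neg, neg_eq_zero] at hq
        obtain ⟨p, hp⟩ := exists_comp_eq_of_comp_shift_mor₁ hf (q ≫ h') (by
          rw [assoc, ← neg_neg (h' ≫ f⟦1⟧'), ← hv₂, Preadditive.comp_neg, reassoc_of% hq,
            zero_comp, neg_zero])
        obtain ⟨z, hz⟩ := exists_comp_eq_of_comp_mor₃ hfg (q - p ≫ u) (by
          rw [Preadditive.sub_comp, assoc, hu₂, hp, sub_self])
        obtain ⟨y, hy⟩ := exists_comp_eq_of_comp_mor₂ hg z (by
          rw [← neg_neg iR, ← hv₃, Preadditive.comp_neg, ← assoc, hz, Preadditive.sub_comp, hq,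
            assoc, huv, comp_zero, sub_zero, neg_zero])
        refine ⟨p + y ≫ i, ?_⟩
        rw [Preadditive.add_comp, assoc, hu₁, reassoc_of% hy, hz, add_sub_cancel]
      · intro K r hr
        obtain ⟨x, hx⟩ := exists_comp_eq_of_comp_shift_mor₂ hf (r ≫ hR) (by rw [assoc, hr])
        obtain ⟨q, hq⟩ := exists_comp_eq_of_comp_shift_mor₁ hfg x (by
          rw [Functor.map_comp, reassoc_of% hx, hRg, comp_zero])
        obtain ⟨z, hz⟩ := exists_comp_eq_of_comp_mor₃ hg (r + q ≫ v) (by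
          rw [Preadditive.add_comp, assoc, hv₂, ← hx, ← hq, Preadditive.comp_neg, assoc,
            add_neg_cancel])
        refine ⟨q + z ≫ i', ?_⟩
        rw [Preadditive.comp_neg, Preadditive.add_comp, assoc, hv₃, Preadditive.comp_neg, hz]
        abel
      · rw [assoc, ← Functor.map_comp, hu₁, Functor.map_comp, reassoc_of% hRg, zero_comp]

end HomotopyCartesian

/-! ### Triangulations lifted along a separable functor. -/

section HomRetraction

variable {C D : Type*} [Category* C] [Category* D]

/-- A natural retraction of the maps `(X ⟶ Y) → (G.obj X ⟶ G.obj Y)` given by a functor `G`;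
functors which admit one are called separable. -/
structure Functor.HomRetraction (G : D ⥤ C) where
  /-- the retraction on morphisms -/
  retr {X Y : D} : (G.obj X ⟶ G.obj Y) → (X ⟶ Y)
  retr_map {X Y : D} (f : X ⟶ Y) : retr (G.map f) = f
  retr_map_comp {X Y Z : D} (f : X ⟶ Y) (φ : G.obj Y ⟶ G.obj Z) :
    retr (G.map f ≫ φ) = f ≫ retr φ
  retr_comp_map {X Y Z : D} (φ : G.obj X ⟶ G.obj Y) (f : Y ⟶ Z) :
    retr (φ ≫ G.map f) = retr φ ≫ f

namespace Functor.HomRetraction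

variable {G : D ⥤ C} (r : G.HomRetraction)

variable [HasZeroObject C] [HasShift C ℤ] [Preadditive C]
  [∀ n : ℤ, (shiftFunctor C n).Additive] [Pretriangulated C]
  [HasZeroObject D] [HasShift D ℤ] [Preadditive D]
  [∀ n : ℤ, (shiftFunctor D n).Additive] [G.CommShift ℤ] [G.Additive]

/-- If a separable functor `G : D ⥤ C` to a pretriangulated category commutes with the shift and
each morphism of `D` has a cone which `G` sends to a distinguished triangle, then `D` is
pretriangulated: the distinguished triangles are those whose image by `G` is distinguished. -/
@[reducible]
def pretriangulated (cone : ∀ {X Y : D} (f : X ⟶ Y),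
    ∃ (Z : D) (g : Y ⟶ Z) (h : Z ⟶ X⟦(1 : ℤ)⟧),
      G.mapTriangle.obj (Triangle.mk f g h) ∈ distTriang C) : Pretriangulated D where
  distinguishedTriangles := {T | G.mapTriangle.obj T ∈ distTriang C}
  isomorphic_distinguished T₁ h₁ T₂ e :=
    isomorphic_distinguished _ h₁ _ (G.mapTriangle.mapIso e)
  contractible_distinguished X :=
    isomorphic_distinguished _ (contractible_distinguished (G.obj X)) _
      (Triangle.isoMk _ _ (Iso.refl _) (Iso.refl _)
        (IsZero.iso (G.map_isZero (isZero_zero D)) (isZero_zero C))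
        ((comp_id _).trans ((G.map_id X).trans (id_comp _).symm))
        ((isZero_zero C).eq_of_tgt _ _)
        ((G.map_isZero (isZero_zero D)).eq_of_src _ _))
  distinguished_cocone_triangle := cone
  rotate_distinguished_triangle T :=
    (rotate_distinguished_triangle _).trans (distinguished_iff_of_iso (G.mapTriangleRotateIso.app T))
  complete_distinguished_triangle_morphism T₁ T₂ h₁ h₂ a b comm := by
    obtain ⟨c, hc₁, hc₂⟩ := complete_distinguished_triangle_morphism _ _ h₁ h₂ (G.map a) (G.map b)
      (by
        change G.map _ ≫ G.map _ = G.map _ ≫ G.map _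
        rw [← G.map_comp, comm, G.map_comp])
    change G.obj T₁.obj₃ ⟶ G.obj T₂.obj₃ at c
    replace hc₁ : G.map T₁.mor₂ ≫ c = G.map b ≫ G.map T₂.mor₂ := hc₁
    replace hc₂ : (G.map T₁.mor₃ ≫ (G.commShiftIso (1 : ℤ)).hom.app T₁.obj₁) ≫ (G.map a)⟦1⟧' =
      c ≫ G.map T₂.mor₃ ≫ (G.commShiftIso (1 : ℤ)).hom.app T₂.obj₁ := hc₂
    -- Both squares compose `c` only with images of morphisms of `D`, so they survive the
    -- retraction.
    refine ⟨r.retr c, ?_, ?_⟩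
    · rw [← r.retr_map_comp, hc₁, ← G.map_comp, r.retr_map]
    · rw [← r.retr_comp_map, ← r.retr_map (T₁.mor₃ ≫ a⟦1⟧')]
      congr 1
      rw [← cancel_mono ((G.commShiftIso (1 : ℤ)).hom.app T₂.obj₁), assoc, ← hc₂, assoc,
        G.map_comp, assoc]
      congr 1
      exact G.commShiftIso_hom_naturality a 1

end Functor.HomRetraction

namespace Functor.HomRetraction

variable {G : D ⥤ C} (r : G.HomRetraction)
  [HasZeroObject C] [HasShift C ℤ] [Preadditive C]
  [∀ n : ℤ, (shiftFunctor C n).Additive] [Pretriangulated C]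
  [HasZeroObject D] [HasShift D ℤ] [Preadditive D]
  [∀ n : ℤ, (shiftFunctor D n).Additive] [Pretriangulated D]
  [G.CommShift ℤ] [G.IsTriangulated]

-- The cone `W` of `(g, i)` already exists in `D`, so it only has to be compared with `Q`. An
-- octahedron in `C` provides a comparison map, which is then retracted to `D`.
include r in
lemma hasHomotopyCartesianSquares [CategoryTheory.IsTriangulated C] :
    HasHomotopyCartesianSquares D := by
  intro X Y Z P Q f g i h hf i' h' hfg
  have hfi : f ≫ i = 0 := comp_distTriang_mor_zero₁₂ _ hf
  obtain ⟨W, j, d, hW⟩ := distinguished_cocone_triangle (biprod.lift g i)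
  -- The octahedron on `Y ⟶ Z ⊞ P ⟶ P`, with composite `i`, puts `W` in a triangle `W ⟶ X⟦1⟧ ⟶
  -- Z⟦1⟧`.
  have oct := (CategoryTheory.IsTriangulated.octahedron_axiom
    (u₁₂ := G.map (biprod.lift g i)) (u₂₃ := G.map (biprod.snd : Z ⊞ P ⟶ P)) (u₁₃ := G.map i)
    (by rw [← G.map_comp, biprod.lift_snd])
    (G.map_distinguished _ hW)
    (G.map_distinguished _ (rot_of_distTriang _ (binaryBiproductTriangle_distinguished Z P)))
    (G.map_distinguished _ (rot_of_distTriang _ hf))).some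
  let θ (A : D) := (G.commShiftIso (1 : ℤ)).hom.app A
  have nat {A B : D} (φ : A ⟶ B) : G.map (φ⟦1⟧') ≫ θ B = θ A ≫ (G.map φ)⟦1⟧' :=
    G.commShiftIso_hom_naturality φ 1
  obtain ⟨m₁, m₃, c₁, c₂, -, c₄, mem⟩ := oct
  change G.obj W ⟶ G.obj (X⟦(1 : ℤ)⟧) at m₁
  change G.obj (X⟦(1 : ℤ)⟧) ⟶ G.obj (Z⟦(1 : ℤ)⟧) at m₃
  replace c₁ : G.map j ≫ m₁ = G.map biprod.snd ≫ G.map h := c₁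
  replace c₂ : m₁ ≫ G.map (-f⟦1⟧') ≫ θ Y = G.map d ≫ θ Y := c₂
  replace c₄ : (G.map (-f⟦1⟧') ≫ θ Y) ≫ (G.map (biprod.lift g i))⟦1⟧' =
    m₃ ≫ G.map (-biprod.inl⟦1⟧') ≫ θ (Z ⊞ P) := c₄
  replace mem : Triangle.mk m₁ m₃ ((G.map (-(biprod.inl : Z ⟶ Z ⊞ P)⟦1⟧') ≫ θ (Z ⊞ P)) ≫
    (G.map j)⟦1⟧') ∈ distTriang C := mem
  replace c₂ : m₁ ≫ G.map (f⟦1⟧') = -G.map d := by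
    rw [← cancel_mono (θ Y), assoc, Preadditive.neg_comp, ← c₂, G.map_neg, Preadditive.neg_comp,
      Preadditive.comp_neg, neg_neg]
  -- The commutativities force `m₃`; the triangle can thus be compared with the rotated one on `f ≫
  -- g`, up to the sign absorbed by `-𝟙` below.
  replace c₄ : m₃ = G.map ((f ≫ g)⟦1⟧') := by
    rw [assoc, ← nat, ← assoc, ← assoc, cancel_mono] at c₄
    have := c₄ =≫ G.map (biprod.fst⟦1⟧')
    simpa only [assoc, ← G.map_comp, Preadditive.neg_comp, ← Functor.map_comp, biprod.lift_fst,
      biprod.inl_fst, G.map_neg, Preadditive.comp_neg, Functor.map_id, comp_id, neg_inj]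
      using this.symm
  obtain ⟨a, ha₁, ha₂⟩ := complete_distinguished_triangle_morphism₁ _ _ mem
    (G.map_distinguished _ (rot_of_distTriang _ (rot_of_distTriang _ hfg)))
    (𝟙 (G.obj (X⟦(1 : ℤ)⟧))) (-𝟙 (G.obj (Z⟦(1 : ℤ)⟧))) (by
      change m₃ ≫ (-𝟙 _) = 𝟙 _ ≫ G.map (-(f ≫ g)⟦1⟧')
      rw [c₄, Preadditive.comp_neg, comp_id, id_comp, G.map_neg])
  change G.obj W ⟶ G.obj Q at a
  replace ha₁ : m₁ ≫ 𝟙 _ = a ≫ G.map h' := ha₁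
  replace ha₂ : ((G.map (-(biprod.inl : Z ⟶ Z ⊞ P)⟦1⟧') ≫ θ (Z ⊞ P)) ≫ (G.map j)⟦1⟧') ≫ a⟦1⟧' =
    (-𝟙 _) ≫ G.map (-i'⟦1⟧') ≫ θ Q := ha₂
  rw [comp_id] at ha₁
  replace ha₂ : G.map (biprod.inl ≫ j) ≫ a = G.map (-i') := by
    apply (shiftFunctor C (1 : ℤ)).map_injective
    rw [← cancel_epi (θ Z), Functor.map_comp, G.map_comp, Functor.map_comp, assoc,
      ← reassoc_of% (nat biprod.inl), ← nat (-i'), ← neg_inj]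
    simpa only [G.map_neg, Functor.map_neg, Preadditive.neg_comp, Preadditive.comp_neg, assoc,
      id_comp, neg_neg] using ha₂
  -- `G.map α` may differ from `a`, so only the relations pass to `α`; its invertibility comes from
  -- the exactness checks below.
  let α := r.retr a
  have hα₁ : biprod.inl ≫ j ≫ α = -i' := by
    rw [← assoc, ← r.retr_map_comp, ha₂, r.retr_map]
  have hα₂ : biprod.inr ≫ j ≫ α ≫ h' = h := by
    rw [← r.retr_comp_map, ← ha₁, ← r.retr_map_comp, c₁, ← G.map_comp, r.retr_map,
      biprod.inr_snd_assoc]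
  have hα₃ : α ≫ h' ≫ f⟦1⟧' = -d := by
    rw [← assoc, ← r.retr_comp_map, ← ha₁, ← r.retr_comp_map, c₂, ← G.map_neg, r.retr_map]
  have hj : j ≫ α = biprod.desc (-i') (biprod.inr ≫ j ≫ α) := by
    apply biprod.hom_ext'
    · rw [biprod.inl_desc, hα₁]
    · rw [biprod.inr_desc]
  have hu : i ≫ biprod.inr ≫ j ≫ α = g ≫ i' := by
    have hz : biprod.lift g i ≫ j = 0 := comp_distTriang_mor_zero₁₂ _ hW
    have := hz =≫ α
    rw [assoc, hj, biprod.lift_desc, zero_comp, Preadditive.comp_neg, neg_add_eq_zero] at this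
    exact this.symm
  have hih : i' ≫ h' = 0 := comp_distTriang_mor_zero₂₃ _ hfg
  have hfg' : h' ≫ (f ≫ g)⟦1⟧' = 0 := comp_distTriang_mor_zero₃₁ _ hfg
  have hu' : (biprod.inr ≫ j ≫ α) ≫ h' = h := by rw [assoc, assoc, hα₂]
  refine ⟨biprod.inr ≫ j ≫ α, hu, hu', distinguished_of_exact hW α hj ?_ ?_ ?_ ?_⟩
  · rw [Preadditive.comp_neg, hα₃, neg_neg]
  all_goals
    generalize biprod.inr ≫ j ≫ α = u at hu hu'
  · intro K y hy
    have hy' : (y ≫ biprod.snd) ≫ u = (y ≫ biprod.fst) ≫ i' := by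
      rw [biprod.desc_eq, Preadditive.comp_neg, Preadditive.comp_add, Preadditive.comp_neg,
        neg_add_eq_zero] at hy
      rw [assoc, assoc, hy]
    obtain ⟨t, ht⟩ := exists_comp_eq_of_comp_mor₃ hf (y ≫ biprod.snd) (by
      rw [← hu', ← assoc, hy', assoc, hih, comp_zero])
    obtain ⟨x, hx⟩ := exists_comp_eq_of_comp_mor₂ hfg (t ≫ g - y ≫ biprod.fst) (by
      rw [Preadditive.sub_comp, ← hy', ← ht, assoc, assoc, hu, sub_self])
    refine ⟨t - x ≫ f, ?_⟩
    apply biprod.hom_ext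
    · rw [assoc, biprod.lift_fst, Preadditive.sub_comp, assoc, hx, sub_sub_cancel]
    · rw [assoc, biprod.lift_snd, Preadditive.sub_comp, assoc, hfi, comp_zero, sub_zero, ht]
  · intro K q hq
    obtain ⟨p, hp⟩ := exists_comp_eq_of_comp_shift_mor₁ hf (q ≫ h') (by
      rwa [Preadditive.comp_neg, neg_eq_zero, ← assoc] at hq)
    obtain ⟨z, hz⟩ := exists_comp_eq_of_comp_mor₃ hfg (q - p ≫ u) (by
      rw [Preadditive.sub_comp, assoc, hu', hp, sub_self])
    refine ⟨biprod.lift (-z) p, ?_⟩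
    rw [biprod.lift_desc, Preadditive.neg_comp, Preadditive.comp_neg, neg_neg, hz, sub_add_cancel]
  · have : f ≫ biprod.lift g i = (f ≫ g) ≫ biprod.inl := by
      apply biprod.hom_ext <;> simp [hfi]
    rw [Preadditive.neg_comp, assoc, ← Functor.map_comp, this, Functor.map_comp,
      reassoc_of% hfg', zero_comp, neg_zero]

end Functor.HomRetraction
end HomRetraction
end CategoryTheory

namespace CategoryTheory.Monad

lemma Algebra.eqToHom_f {C : Type u} [Category.{v} C] {T : Monad C} {X Y : T.Algebra} (h : X = Y) :
    (eqToHom h).f = eqToHom (congrArg Algebra.A h) := by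
  subst h; rfl

/-! ### The shift on modules over a stable monad. -/

section Shift

variable {C : Type u} [Category.{v} C] [HasShift C ℤ] (T : Monad C)
  [T.toFunctor.CommShift ℤ]

lemma commShiftIso_hom_naturality {X Y : C} (f : X ⟶ Y) (n : ℤ) :
    T.map (f⟦n⟧') ≫ (T.toFunctor.commShiftIso n).hom.app Y =
      (T.toFunctor.commShiftIso n).hom.app X ≫ (T.map f)⟦n⟧' :=
  T.toFunctor.commShiftIso_hom_naturality f n

variable [T.IsStable]

lemma η_app_commShiftIso_hom_app (X : C) (n : ℤ) :
    T.η.app (X⟦n⟧) ≫ (T.toFunctor.commShiftIso n).hom.app X = (T.η.app X)⟦n⟧' := by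
  have := IsStable.commShift_η (T := T)
  have h := NatTrans.shift_app_comm T.η n X
  rw [Functor.commShiftIso_id_hom_app] at h
  exact h.symm.trans (id_comp _)

lemma μ_app_commShiftIso_hom_app (X : C) (n : ℤ) :
    T.μ.app (X⟦n⟧) ≫ (T.toFunctor.commShiftIso n).hom.app X =
      T.map ((T.toFunctor.commShiftIso n).hom.app X) ≫
        (T.toFunctor.commShiftIso n).hom.app (T.obj X) ≫ (T.μ.app X)⟦n⟧' := by
  have := IsStable.commShift_μ (T := T)
  have h := NatTrans.shift_app_comm T.μ n X
  rw [Functor.commShiftIso_comp_hom_app] at h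
  exact h.symm.trans (Category.assoc _ _ _)

namespace Algebra

/-- The shift of an algebra over a stable monad. -/
@[simps]
def shift (X : T.Algebra) (n : ℤ) : T.Algebra where
  A := X.A⟦n⟧
  a := (T.toFunctor.commShiftIso n).hom.app X.A ≫ X.a⟦n⟧'
  unit := by
    rw [reassoc_of% (T.η_app_commShiftIso_hom_app X.A n), ← Functor.map_comp, X.unit]
    exact Functor.map_id _ _
  assoc := by
    rw [reassoc_of% (T.μ_app_commShiftIso_hom_app X.A n), ← Functor.map_comp, X.assoc, Functor.map_comp,
      Functor.map_comp, Category.assoc, reassoc_of% (T.commShiftIso_hom_naturality X.a n)]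

/-- The shift functors on the category of algebras over a stable monad. -/
@[simps]
def shiftFunctor (n : ℤ) : T.Algebra ⥤ T.Algebra where
  obj X := shift T X n
  map {X Y} f :=
    { f := f.f⟦n⟧'
      h := by
        dsimp only [shift]
        rw [reassoc_of% (T.commShiftIso_hom_naturality f.f n), Category.assoc, ← Functor.map_comp, f.h,
          Functor.map_comp] }
  map_id X := by ext; exact Functor.map_id _ _
  map_comp f g := by ext; exact Functor.map_comp _ _ _

/-- The compatibility of the shift by zero on algebras with the identity functor. -/
def shiftFunctorZeroIso : shiftFunctor T 0 ≅ 𝟭 T.Algebra :=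
  NatIso.ofComponents (fun X => isoMk ((shiftFunctorZero C ℤ).app X.A) (by
    dsimp only [shiftFunctor, shift, Functor.id_obj]
    rw [Functor.commShiftIso_zero, Functor.CommShift.isoZero_hom_app]
    dsimp
    rw [Category.assoc]
    simp only [Category.assoc]
    congr 1
    exact ((shiftFunctorZero C ℤ).inv_hom_id_app_assoc _ _).symm.trans
      (congr_arg _ ((shiftFunctorZero C ℤ).hom.naturality X.a).symm)))
    (fun f => by ext; exact (shiftFunctorZero C ℤ).hom.naturality f.f)

/-- The compatibility of the shifts on algebras with addition. -/
def shiftFunctorAddIso (n m : ℤ) :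
    shiftFunctor T (n + m) ≅ shiftFunctor T n ⋙ shiftFunctor T m :=
  NatIso.ofComponents (fun X => isoMk ((shiftFunctorAdd C n m).app X.A) (by
    dsimp only [shiftFunctor, shift, Functor.comp_obj]
    rw [Functor.commShiftIso_add, Functor.CommShift.isoAdd_hom_app]
    dsimp
    simp only [Category.assoc, Functor.map_comp]
    congr 3
    exact ((shiftFunctorAdd C n m).inv_hom_id_app_assoc _ _).symm.trans
      (congr_arg _ ((shiftFunctorAdd C n m).hom.naturality X.a).symm)))
    (fun f => by ext; exact (shiftFunctorAdd C n m).hom.naturality f.f)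

/-- The shift on the category of algebras over a stable monad. -/
@[reducible]
def hasShift : HasShift T.Algebra ℤ :=
  hasShiftMk _ _
    { F := shiftFunctor T
      zero := shiftFunctorZeroIso T
      add := shiftFunctorAddIso T
      assoc_hom_app m₁ m₂ m₃ X := by
        ext
        refine (shiftFunctorAdd_assoc_hom_app m₁ m₂ m₃ X.A).trans ?_
        rw [comp_f, comp_f, eqToHom_f]
        dsimp only [shiftFunctorAdd', Iso.trans_hom, NatTrans.comp_app, eqToIso.hom]
        rw [eqToHom_app]
        exact Category.assoc _ _ _
      zero_add_hom_app n X := by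
        ext
        refine (shiftFunctorAdd_zero_add_hom_app n X.A).trans ?_
        rw [comp_f, eqToHom_f]
        rfl
      add_zero_hom_app n X := by
        ext
        refine (shiftFunctorAdd_add_zero_hom_app n X.A).trans ?_
        rw [comp_f, eqToHom_f]
        rfl }

end Algebra

attribute [local instance] Algebra.hasShift

/-- The forgetful functor of a stable monad commutes with the shift. -/
@[reducible]
def forgetCommShift : T.forget.CommShift ℤ where
  commShiftIso n := NatIso.ofComponents (fun X => Iso.refl (X.A⟦n⟧)) (fun f =>
    (comp_id _).trans (id_comp _).symm)
  commShiftIso_zero := by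
    ext X
    rw [Functor.CommShift.isoZero_hom_app]
    exact ((shiftFunctorZero C ℤ).hom_inv_id_app X.A).symm
  commShiftIso_add a b := by
    ext X
    rw [Functor.CommShift.isoAdd_hom_app]
    refine ((shiftFunctorAdd C a b).hom_inv_id_app X.A).symm.trans ?_
    change _ = (shiftFunctorAdd C a b).hom.app X.A ≫ 𝟙 _ ≫ (𝟙 (X.A⟦a⟧))⟦b⟧' ≫
      (shiftFunctorAdd C a b).inv.app X.A
    rw [Functor.map_id, id_comp]
    exact congr_arg _ (id_comp _).symm

/-- The free algebra functor of a stable monad commutes with the shift. -/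
@[reducible]
def freeCommShift : T.free.CommShift ℤ where
  commShiftIso n := NatIso.ofComponents
    (fun X => Algebra.isoMk ((T.toFunctor.commShiftIso n).app X)
      (μ_app_commShiftIso_hom_app T X n).symm)
    (fun f => by ext; exact T.commShiftIso_hom_naturality f n)
  commShiftIso_zero := by
    ext X
    refine (congr_arg (fun e => e.hom.app X) (T.toFunctor.commShiftIso_zero ℤ)).trans ?_
    rw [Functor.CommShift.isoZero_hom_app, Functor.CommShift.isoZero_hom_app]
    rfl
  commShiftIso_add a b := by
    ext X
    refine (congr_arg (fun e => e.hom.app X) (T.toFunctor.commShiftIso_add a b)).trans ?_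
    rw [Functor.CommShift.isoAdd_hom_app, Functor.CommShift.isoAdd_hom_app]
    rfl

attribute [local instance] forgetCommShift freeCommShift

lemma free_comp_forget_commShiftIso_hom_app (X : C) (n : ℤ) :
    ((T.free ⋙ T.forget).commShiftIso n).hom.app X = (T.toFunctor.commShiftIso n).hom.app X := by
  rw [Functor.commShiftIso_comp_hom_app]
  exact comp_id _

lemma forget_comp_free_commShiftIso_hom_app_f (X : T.Algebra) (n : ℤ) :
    (((T.forget ⋙ T.free).commShiftIso n).hom.app X).f =
      (T.toFunctor.commShiftIso n).hom.app X.A := by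
  rw [Functor.commShiftIso_comp_hom_app]
  change T.map (𝟙 (X.A⟦n⟧)) ≫ (T.toFunctor.commShiftIso n).hom.app X.A = _
  rw [Functor.map_id, id_comp]

lemma commShift_freeCompForget_hom : NatTrans.CommShift T.freeCompForget.hom ℤ where
  shift_comm n := by
    ext X
    change ((T.free ⋙ T.forget).commShiftIso n).hom.app X ≫ (𝟙 (T.obj X))⟦n⟧' =
      𝟙 (T.obj (X⟦n⟧)) ≫ (T.toFunctor.commShiftIso n).hom.app X
    rw [free_comp_forget_commShiftIso_hom_app]
    change (T.toFunctor.commShiftIso n).hom.app X ≫ (𝟙 (T.obj X))⟦n⟧' =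
      𝟙 (T.obj (X⟦n⟧)) ≫ (T.toFunctor.commShiftIso n).hom.app X
    rw [Functor.map_id, id_comp]
    exact comp_id _

lemma commShift_adj : T.adj.CommShift ℤ where
  commShift_unit :=
    { shift_comm n := by
        ext X
        rw [adj_unit]
        change ((𝟭 C).commShiftIso n).hom.app X ≫ (T.η.app X)⟦n⟧' =
          T.η.app (X⟦n⟧) ≫ ((T.free ⋙ T.forget).commShiftIso n).hom.app X
        rw [free_comp_forget_commShiftIso_hom_app, Functor.commShiftIso_id_hom_app]
        exact (id_comp _).trans (T.η_app_commShiftIso_hom_app X n).symm }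
  commShift_counit :=
    { shift_comm n := by
        ext X
        change (((T.forget ⋙ T.free).commShiftIso n).hom.app X).f ≫
          (T.adj.counit.app X).f⟦n⟧' =
            (T.adj.counit.app (Algebra.shift T X n)).f ≫
              (((𝟭 T.Algebra).commShiftIso n).hom.app X).f
        rw [forget_comp_free_commShiftIso_hom_app_f, Functor.commShiftIso_id_hom_app]
        simp only [adj_counit]
        exact (comp_id _).symm }

end Shift
end CategoryTheory.Monad

/-! ### Correcting idempotents modulo square-zero errors. -/

lemma isIdempotentElem_of_sq_zero {R : Type*} [Ring R] {e : R}
    (he : (e * e - e) * (e * e - e) = 0) :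
    IsIdempotentElem (e * e + e * e + e * e - (e * e * e + e * e * e)) := by
  rw [IsIdempotentElem, ← sub_eq_zero]
  -- For `q = 3e² - 2e³` one has `q² - q = (e² - e)² (4e² - 4e - 3)`.
  have : (e * e + e * e + e * e - (e * e * e + e * e * e)) *
      (e * e + e * e + e * e - (e * e * e + e * e * e)) -
      (e * e + e * e + e * e - (e * e * e + e * e * e)) =
      (e * e - e) * (e * e - e) * (4 * (e * e) - 4 * e - 3) := by
    noncomm_ring
  rw [this, he, zero_mul]

namespace CategoryTheory

section Idempotents

variable {C : Type*} [Category* C] [Preadditive C] {Z : C}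

/-- The polynomial `3 e² - 2 e³` of an endomorphism `e`, which is idempotent when `e` is idempotent
up to a square zero endomorphism. -/
def idempotentCorrection (e : Z ⟶ Z) : Z ⟶ Z :=
  e ≫ e + e ≫ e + e ≫ e - (e ≫ e ≫ e + e ≫ e ≫ e)

lemma idempotentCorrection_comp_self {e : Z ⟶ Z} (he : (e ≫ e - e) ≫ (e ≫ e - e) = 0) :
    idempotentCorrection e ≫ idempotentCorrection e = idempotentCorrection e :=
  isIdempotentElem_of_sq_zero (R := End Z) (e := e) he

/-- Every positive power of `e` acts on `x` as `y`, and the coefficients of `3e² - 2e³` sum to `1`.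
-/
lemma comp_idempotentCorrection {X : C} {x : X ⟶ Z} {y : X ⟶ X} {e : Z ⟶ Z}
    (h : x ≫ e = y ≫ x) (hy : y ≫ y = y) : x ≫ idempotentCorrection e = y ≫ x := by
  have h₂ : x ≫ e ≫ e = y ≫ x := by rw [reassoc_of% h, h, reassoc_of% hy]
  have h₃ : x ≫ e ≫ e ≫ e = y ≫ x := by rw [reassoc_of% h, h₂, reassoc_of% hy]
  simp only [idempotentCorrection, Preadditive.comp_sub, Preadditive.comp_add, h₂, h₃]
  abel

lemma idempotentCorrection_comp {X : C} {x : Z ⟶ X} {y : X ⟶ X} {e : Z ⟶ Z}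
    (h : e ≫ x = x ≫ y) (hy : y ≫ y = y) : idempotentCorrection e ≫ x = x ≫ y := by
  simp only [idempotentCorrection, Preadditive.sub_comp, Preadditive.add_comp, assoc, h,
    reassoc_of% h, hy]
  abel

end Idempotents

section

variable {C : Type*} [Category* C] [HasZeroObject C] [HasShift C ℤ] [Preadditive C]
  [∀ n : ℤ, (shiftFunctor C n).Additive] [Pretriangulated C]
  {X Y Z : C} {f : X ⟶ Y} {g : Y ⟶ Z} {h : Z ⟶ X⟦(1 : ℤ)⟧}

/-- The first condition makes `n` factor through `h`, which the second one kills. -/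
lemma Pretriangulated.comp_self_eq_zero (hT : Triangle.mk f g h ∈ distTriang C) {n : Z ⟶ Z}
    (hg : g ≫ n = 0) (hh : n ≫ h = 0) : n ≫ n = 0 := by
  obtain ⟨t, ht⟩ : ∃ t : X⟦(1 : ℤ)⟧ ⟶ Z, n = h ≫ t := Triangle.yoneda_exact₃ _ hT n hg
  nth_rw 2 [ht]
  rw [reassoc_of% hh, zero_comp]

lemma Pretriangulated.isIso_of_comp_eq_self (hT : Triangle.mk f g h ∈ distTriang C) {κ : Z ⟶ Z}
    (hg : g ≫ κ = g) (hh : κ ≫ h = h) : IsIso κ :=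
  isIso₃_of_isIso₁₂
    ({hom₁ := 𝟙 X, hom₂ := 𝟙 Y, hom₃ := κ
      comm₁ := (comp_id _).trans (id_comp _).symm
      comm₂ := hg.trans (id_comp _).symm
      comm₃ := by
        change h ≫ (𝟙 X)⟦1⟧' = κ ≫ h
        rw [hh, Functor.map_id, comp_id] } : Triangle.mk f g h ⟶ Triangle.mk f g h)
    hT hT (IsIso.id X) (IsIso.id Y)

end

namespace Monad

/-! ### Sections of actions and averaging over a separable monad. -/

section Separable

variable {C : Type u} [Category.{v} C] (T : Monad C)

/-- The algebra structure on a retract of a free algebra by a linear idempotent. -/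
@[simps]
def Algebra.ofRetract {Z : C} (i : Z ⟶ T.obj Z) (p : T.obj Z ⟶ Z) (hip : i ≫ p = 𝟙 Z)
    (hlin : T.μ.app Z ≫ p ≫ i = T.map (p ≫ i) ≫ T.μ.app Z) : T.Algebra where
  A := Z
  a := T.map i ≫ T.μ.app Z ≫ p
  unit := by
    have := T.η.naturality_assoc i (T.μ.app Z ≫ p)
    dsimp at this
    rw [← this, T.left_unit_assoc, hip]
  assoc := by
    have nat := T.μ.naturality_assoc i (T.μ.app Z ≫ p)
    dsimp at nat
    have hlin' := hlin =≫ p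
    simp only [Functor.map_comp, Category.assoc, hip, comp_id] at hlin' ⊢
    rw [← hlin', reassoc_of% (T.assoc Z), nat]

variable {T} (σ : T.toFunctor ⟶ T.toFunctor ⋙ T.toFunctor)

/-- The section of the action `M X ⟶ X` of an algebra given by a separating section. -/
def Algebra.sec (X : T.Algebra) : X.A ⟶ T.obj X.A :=
  T.η.app X.A ≫ σ.app X.A ≫ T.map X.a

lemma Algebra.sec_naturality {X Y : T.Algebra} (f : X ⟶ Y) :
    X.sec σ ≫ T.map f.f = f.f ≫ Y.sec σ := by
  have h₁ := T.η.naturality_assoc f.f (σ.app Y.A ≫ T.map Y.a)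
  have h₂ := σ.naturality_assoc f.f (T.map Y.a)
  dsimp at h₁ h₂
  simp only [sec, Category.assoc]
  rw [h₁, h₂, ← Functor.map_comp, ← Functor.map_comp, f.h]

variable {σ} (hσ : T.IsSeparatingSection σ)
include hσ

lemma IsSeparatingSection.sec_comp_a (X : T.Algebra) : X.sec σ ≫ X.a = 𝟙 X.A := by
  have h := NatTrans.congr_app hσ.section_mul X.A
  dsimp at h
  simp only [Algebra.sec, Category.assoc]
  rw [← X.assoc, reassoc_of% h, X.unit]

/-- Linearity of the section: both sides equal `σ_X ≫ M a`, the left by `left_linear` and the right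
by `right_linear`. -/
lemma IsSeparatingSection.a_comp_sec (X : T.Algebra) :
    X.a ≫ X.sec σ = T.map (X.sec σ) ≫ T.μ.app X.A := by
  have h₁ := T.η.naturality_assoc X.a (σ.app X.A ≫ T.map X.a)
  have h₂ := σ.naturality_assoc X.a (T.map X.a)
  have h₃ := T.μ.naturality X.a
  dsimp at h₁ h₂ h₃
  simp only [Algebra.sec, Functor.map_comp, Category.assoc]
  rw [h₁, h₂, h₃, reassoc_of% (hσ.right_linear X.A), T.right_unit_assoc, ← Functor.map_comp,
    ← X.assoc, Functor.map_comp, reassoc_of% (hσ.left_linear X.A), T.left_unit_assoc]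

/-- A morphism between the underlying objects of two algebras over a separable monad can be
averaged to a morphism of algebras. -/
@[simps]
def IsSeparatingSection.average {X Y : T.Algebra} (φ : X.A ⟶ Y.A) : X ⟶ Y where
  f := X.sec σ ≫ T.map φ ≫ Y.a
  h := by
    have h := T.μ.naturality_assoc φ Y.a
    dsimp at h
    simp only [Functor.map_comp, Category.assoc]
    rw [← Y.assoc, h, reassoc_of% (hσ.a_comp_sec X)]

lemma IsSeparatingSection.average_f_eq_self {X Y : T.Algebra} (f : X ⟶ Y) :
    hσ.average f.f = f := by
  ext
  rw [average_f, reassoc_of% (Algebra.sec_naturality σ f), hσ.sec_comp_a, comp_id]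

lemma IsSeparatingSection.average_f_comp {X Y Z : T.Algebra} (f : X ⟶ Y) (φ : Y.A ⟶ Z.A) :
    hσ.average (f.f ≫ φ) = f ≫ hσ.average φ := by
  ext
  rw [average_f, Algebra.comp_f, average_f, Functor.map_comp, Category.assoc,
    reassoc_of% (Algebra.sec_naturality σ f)]

lemma IsSeparatingSection.average_comp_f {X Y Z : T.Algebra} (φ : X.A ⟶ Y.A) (f : Y ⟶ Z) :
    hσ.average (φ ≫ f.f) = hσ.average φ ≫ f := by
  ext
  rw [average_f, Algebra.comp_f, average_f, Functor.map_comp, Category.assoc, Category.assoc,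
    Category.assoc, f.h]

/-- The forgetful functor of a separable monad is separable. -/
def IsSeparatingSection.homRetraction : T.forget.HomRetraction where
  retr {X Y} φ := hσ.average (X := X) (Y := Y) φ
  retr_map := hσ.average_f_eq_self
  retr_map_comp := hσ.average_f_comp
  retr_comp_map := hσ.average_comp_f

end Separable

/-! ### Module structures on cones. -/

section Cone

variable {C : Type u} [Category.{v} C] [HasShift C ℤ] {T : Monad C}
  [T.toFunctor.CommShift ℤ] {σ : T.toFunctor ⟶ T.toFunctor ⋙ T.toFunctor}

/-- This is where compatibility of `σ` with the shift enters: a fill-in over the shifted section is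
one over the section of the shifted module. -/
lemma Algebra.sec_shift [T.IsStable] [NatTrans.CommShift σ ℤ] (X : T.Algebra) (n : ℤ) :
    (X.shift T n).sec σ ≫ (T.toFunctor.commShiftIso n).hom.app X.A = (X.sec σ)⟦n⟧' := by
  have h := NatTrans.shift_app_comm σ n X.A
  rw [Functor.commShiftIso_comp_hom_app] at h
  dsimp at h
  dsimp only [sec, shift]
  simp only [Functor.map_comp, Category.assoc]
  rw [commShiftIso_hom_naturality, ← reassoc_of% h, reassoc_of% (T.η_app_commShiftIso_hom_app X.A n)]

variable [HasZeroObject C] [Preadditive C] [∀ n : ℤ, (shiftFunctor C n).Additive]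
  [Pretriangulated C] [T.toFunctor.IsTriangulated]

/-- Let `Z` be the cone of a morphism `A ⟶ B`, and let `w : Z ⟶ M Z` and `p₀ : M Z ⟶ Z` be
morphisms which are compatible with actions of `M` on `B` and `A⟦1⟧` and their sections. Then
`Z` is the retract of `M Z` by a linear idempotent, compatibly with the actions. -/
lemma exists_retract {A B Z : C} {f : A ⟶ B} {g : B ⟶ Z}
    {h : Z ⟶ A⟦(1 : ℤ)⟧} (hT : Triangle.mk f g h ∈ distTriang C)
    {a : T.obj B ⟶ B} {s : B ⟶ T.obj B} (hsa : s ≫ a = 𝟙 B)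
    {a' : T.obj (A⟦(1 : ℤ)⟧) ⟶ A⟦(1 : ℤ)⟧} {s' : A⟦(1 : ℤ)⟧ ⟶ T.obj (A⟦(1 : ℤ)⟧)}
    (hsa' : s' ≫ a' = 𝟙 _) (has : T.map s ≫ T.μ.app B = a ≫ s)
    (has' : T.map s' ≫ T.μ.app (A⟦(1 : ℤ)⟧) = a' ≫ s')
    {w : Z ⟶ T.obj Z} (hw : g ≫ w = s ≫ T.map g) (hw' : w ≫ T.map h = h ≫ s')
    {p₀ : T.obj Z ⟶ Z} (hp : T.map g ≫ p₀ = a ≫ g) (hp' : p₀ ≫ h = T.map h ≫ a') :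
    ∃ (i : Z ⟶ T.obj Z) (p : T.obj Z ⟶ Z), i ≫ p = 𝟙 Z ∧
      T.μ.app Z ≫ p ≫ i = T.map (p ≫ i) ≫ T.μ.app Z ∧
      g ≫ i = s ≫ T.map g ∧ i ≫ T.map h = h ≫ s' ∧
      T.map g ≫ p = a ≫ g ∧ p ≫ h = T.map h ≫ a' := by
  have hMT : Triangle.mk (T.map f) (T.map g)
      (T.map h ≫ (T.toFunctor.commShiftIso (1 : ℤ)).hom.app A) ∈ distTriang C :=
    T.toFunctor.map_distinguished _ hT
  have comp_self_eq_zero {n : T.obj Z ⟶ T.obj Z} (hg : T.map g ≫ n = 0) (hh : n ≫ T.map h = 0) :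
      n ≫ n = 0 :=
    Pretriangulated.comp_self_eq_zero hMT hg (by rw [reassoc_of% hh, zero_comp])
  have idem : (a ≫ s) ≫ a ≫ s = a ≫ s := by rw [Category.assoc, reassoc_of% hsa]
  have idem' : (a' ≫ s') ≫ a' ≫ s' = a' ≫ s' := by rw [Category.assoc, reassoc_of% hsa']
  -- The linear extension of `w` to the free module. Against `M g` and `M h` it acts as the
  -- idempotents `a ≫ s` and `a' ≫ s'`, so `u₀² - u₀` has square zero.
  let u₀ : T.obj Z ⟶ T.obj Z := T.map w ≫ T.μ.app Z
  have hu₀ : T.map g ≫ u₀ = (a ≫ s) ≫ T.map g := by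
    have nat := T.μ.naturality g
    dsimp at nat
    rw [← Functor.map_comp_assoc, hw, Functor.map_comp, Category.assoc, nat, reassoc_of% has,
      Category.assoc]
  have hu₀' : u₀ ≫ T.map h = T.map h ≫ a' ≫ s' := by
    have nat := T.μ.naturality h
    dsimp at nat
    rw [Category.assoc, ← nat, ← Functor.map_comp_assoc, hw', Functor.map_comp, Category.assoc,
      has']
  have lin₀ : T.μ.app Z ≫ u₀ = T.map u₀ ≫ T.μ.app Z := by
    have nat := T.μ.naturality_assoc w (T.μ.app Z)
    dsimp at nat
    rw [Functor.map_comp, Category.assoc, T.assoc, nat]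
  obtain ⟨u, huu, hu, hu', lin⟩ : ∃ u : T.obj Z ⟶ T.obj Z, u ≫ u = u ∧
      T.map g ≫ u = (a ≫ s) ≫ T.map g ∧ u ≫ T.map h = T.map h ≫ a' ≫ s' ∧
      T.μ.app Z ≫ u = T.map u ≫ T.μ.app Z := by
    refine ⟨idempotentCorrection u₀, idempotentCorrection_comp_self (comp_self_eq_zero ?_ ?_),
      comp_idempotentCorrection hu₀ idem, idempotentCorrection_comp hu₀' idem', ?_⟩
    · simp only [Preadditive.comp_sub, reassoc_of% hu₀, hu₀, Category.assoc, reassoc_of% hsa,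
        sub_self]
    · rw [Preadditive.sub_comp, Category.assoc, hu₀', reassoc_of% hu₀', reassoc_of% hsa',
        sub_self]
    · simp only [idempotentCorrection, Preadditive.comp_sub, Preadditive.comp_add,
        Preadditive.sub_comp, Preadditive.add_comp, Functor.map_sub, Functor.map_add,
        Functor.map_comp T.toFunctor u₀, Category.assoc, ← lin₀, reassoc_of% lin₀]
  clear_value u₀
  have hκ : g ≫ w ≫ u ≫ p₀ = g := by
    rw [reassoc_of% hw, reassoc_of% hu, hp, reassoc_of% hsa, reassoc_of% hsa]
  have hκ' : (w ≫ u ≫ p₀) ≫ h = h := by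
    rw [Category.assoc, Category.assoc, hp', reassoc_of% hu', hsa', comp_id, reassoc_of% hw',
      hsa', comp_id]
  -- The inverse of this automorphism rescales `p₀` so that `i ≫ p` becomes exactly the identity.
  have : IsIso (w ≫ u ≫ p₀) := isIso_of_comp_eq_self hT hκ hκ'
  have hκ₁ : g ≫ inv (w ≫ u ≫ p₀) = g := by rw [IsIso.comp_inv_eq, hκ]
  have hκ₂ : inv (w ≫ u ≫ p₀) ≫ h = h := by rw [IsIso.inv_comp_eq, hκ']
  obtain ⟨i, hi⟩ : ∃ i, i = w ≫ u := ⟨_, rfl⟩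
  obtain ⟨p, hp₀⟩ : ∃ p, p = u ≫ p₀ ≫ inv (w ≫ u ≫ p₀) := ⟨_, rfl⟩
  have hip : i ≫ p = 𝟙 Z := by
    rw [hi, hp₀, Category.assoc, reassoc_of% huu]
    simpa only [Category.assoc] using IsIso.hom_inv_id (w ≫ u ≫ p₀)
  have hgi : g ≫ i = s ≫ T.map g := by
    rw [hi, reassoc_of% hw, hu, Category.assoc, reassoc_of% hsa]
  have hih : i ≫ T.map h = h ≫ s' := by
    rw [hi, Category.assoc, hu', reassoc_of% hw', reassoc_of% hsa']
  have hgp : T.map g ≫ p = a ≫ g := by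
    rw [hp₀, reassoc_of% hu, reassoc_of% hp, hκ₁, reassoc_of% hsa]
  have hph : p ≫ h = T.map h ≫ a' := by
    rw [hp₀, Category.assoc, Category.assoc, hκ₂, hp', reassoc_of% hu', hsa', comp_id]
  have hup : u ≫ p = p := by rw [hp₀, reassoc_of% huu]
  have hiu : i ≫ u = i := by rw [hi, Category.assoc, huu]
  -- The difference `u - p ≫ i` is idempotent and has square zero, hence vanishes.
  have hpi : p ≫ i = u := by
    have h₀ : (u - p ≫ i) ≫ (u - p ≫ i) = 0 := comp_self_eq_zero
      (by rw [Preadditive.comp_sub, hu, reassoc_of% hgp, hgi, Category.assoc, sub_self])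
      (by rw [Preadditive.sub_comp, hu', Category.assoc, hih, reassoc_of% hph, sub_self])
    rw [Preadditive.comp_sub, Preadditive.sub_comp, Preadditive.sub_comp, huu, Category.assoc, hiu,
      reassoc_of% hup, Category.assoc, reassoc_of% hip, sub_self, sub_zero, sub_eq_zero] at h₀
    exact h₀.symm
  exact ⟨i, p, hip, by rw [hpi, lin], hgi, hih, hgp, hph⟩

attribute [local instance] Algebra.hasShift forgetCommShift freeCommShift

/-- A morphism of algebras over a stably separable monad has a cone in the category of algebras. -/
lemma IsSeparatingSection.exists_cone [T.IsStable] [NatTrans.CommShift σ ℤ]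
    (hσ : T.IsSeparatingSection σ) {X Y : T.Algebra} (f : X ⟶ Y) :
    ∃ (Z : T.Algebra) (g : Y ⟶ Z) (h : Z ⟶ X⟦(1 : ℤ)⟧),
      T.forget.mapTriangle.obj (Triangle.mk f g h) ∈ distTriang C := by
  obtain ⟨Z, g, h, hT⟩ := distinguished_cocone_triangle f.f
  have hMT : Triangle.mk (T.map f.f) (T.map g)
      (T.map h ≫ (T.toFunctor.commShiftIso (1 : ℤ)).hom.app X.A) ∈ distTriang C :=
    T.toFunctor.map_distinguished _ hT
  obtain ⟨w, hw, hw'⟩ := exists_fill hT hMT (X.sec σ) (Y.sec σ) (Algebra.sec_naturality σ f).symm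
  obtain ⟨p₀, hp, hp'⟩ := exists_fill hMT hT X.a Y.a f.h
  obtain ⟨a', s', ha', hs', hsa', has'⟩ : ∃ (a' : T.obj (X.A⟦(1 : ℤ)⟧) ⟶ X.A⟦(1 : ℤ)⟧)
      (s' : X.A⟦(1 : ℤ)⟧ ⟶ T.obj (X.A⟦(1 : ℤ)⟧)),
      a' = (T.toFunctor.commShiftIso (1 : ℤ)).hom.app X.A ≫ X.a⟦1⟧' ∧
      s' ≫ (T.toFunctor.commShiftIso (1 : ℤ)).hom.app X.A = (X.sec σ)⟦1⟧' ∧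
      s' ≫ a' = 𝟙 _ ∧ T.map s' ≫ T.μ.app (X.A⟦(1 : ℤ)⟧) = a' ≫ s' :=
    ⟨(X.shift T 1).a, (X.shift T 1).sec σ, rfl, Algebra.sec_shift X 1,
      hσ.sec_comp_a (X.shift T 1), (hσ.a_comp_sec (X.shift T 1)).symm⟩
  replace hw' : w ≫ T.map h = h ≫ s' := by
    rw [← cancel_mono ((T.toFunctor.commShiftIso (1 : ℤ)).hom.app X.A)]
    exact (Category.assoc _ _ _).trans (hw'.symm.trans
      ((congr_arg _ hs'.symm).trans (Category.assoc _ _ _).symm))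
  rw [Category.assoc, ← ha'] at hp'
  obtain ⟨i, p, hip, lin, hgi, hih, hgp, hph⟩ := exists_retract hT (hσ.sec_comp_a Y) hsa'
    (hσ.a_comp_sec Y).symm has' hw hw' hp hp'.symm
  have natg := T.μ.naturality_assoc g p
  have nath := T.μ.naturality_assoc h a'
  dsimp at natg nath
  refine ⟨Algebra.ofRetract T i p hip lin, { f := g, h := ?_ }, { f := h, h := ?_ }, ?_⟩
  · change T.map g ≫ T.map i ≫ T.μ.app Z ≫ p = Y.a ≫ g
    rw [← Functor.map_comp_assoc, hgi, Functor.map_comp, Category.assoc, natg, hgp,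
      ← reassoc_of% (hσ.a_comp_sec Y), reassoc_of% (hσ.sec_comp_a Y)]
  · change T.map h ≫ (T.toFunctor.commShiftIso (1 : ℤ)).hom.app X.A ≫ X.a⟦1⟧' =
      (T.map i ≫ T.μ.app Z ≫ p) ≫ h
    rw [← ha', Category.assoc, Category.assoc, hph, ← nath, ← Functor.map_comp_assoc, hih,
      Functor.map_comp, Category.assoc, reassoc_of% has', hsa', comp_id]
  · refine isomorphic_distinguished _ hT _
      (Triangle.isoMk _ _ (Iso.refl _) (Iso.refl _) (Iso.refl _) ?_ ?_ ?_)
    · exact (comp_id _).trans (id_comp _).symm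
    · exact (comp_id _).trans (id_comp _).symm
    · change (h ≫ 𝟙 _) ≫ (𝟙 X.A)⟦1⟧' = 𝟙 Z ≫ h
      rw [Functor.map_id, comp_id, comp_id, id_comp]

end Cone

lemma hasZeroObject_algebra {C : Type u} [Category.{v} C] [Preadditive C] [HasZeroObject C]
    (T : Monad C) [T.toFunctor.Additive] : HasZeroObject T.Algebra := by
  obtain ⟨Z, hZ⟩ := HasZeroObject.zero (C := C)
  have h : IsZero (T.obj Z) := T.toFunctor.map_isZero hZ
  exact ⟨T.free.obj Z, fun _ => ⟨⟨⟨0⟩, fun _ => Algebra.Hom.ext (h.eq_of_src _ _)⟩⟩,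
    fun _ => ⟨⟨⟨0⟩, fun _ => Algebra.Hom.ext (h.eq_of_tgt _ _)⟩⟩⟩

end Monad

end CategoryTheory

/-! ### The triangulated structure on modules. -/

theorem mainTheorem4 {C : Type u} [Category.{v} C] [HasZeroObject C] [HasShift C ℤ]
    [Preadditive C] [∀ n : ℤ, (shiftFunctor C n).Additive]
    [Pretriangulated C] [IsTriangulated C]
    (T : Monad C) [T.toFunctor.CommShift ℤ] [T.toFunctor.IsTriangulated]
    [T.IsStablySeparable] :
    ∃ (_ : HasZeroObject T.Algebra) (_ : HasShift T.Algebra ℤ)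
      (_ : ∀ n : ℤ, (shiftFunctor T.Algebra n).Additive)
      (_ : Pretriangulated T.Algebra) (_ : IsTriangulated T.Algebra)
      (_ : T.free.CommShift ℤ) (_ : T.forget.CommShift ℤ),
      T.free.IsTriangulated ∧ T.forget.IsTriangulated ∧
      T.adj.CommShift ℤ ∧ NatTrans.CommShift T.freeCompForget.hom ℤ := by
  obtain ⟨σ, hσ, _⟩ := Monad.IsStablySeparable.exists_section (T := T)
  let := Monad.Algebra.hasShift T
  let := Monad.forgetCommShift T
  let := Monad.freeCommShift T
  have := Monad.hasZeroObject_algebra T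
  have : ∀ n : ℤ, (shiftFunctor T.Algebra n).Additive := fun n =>
    ⟨fun {X Y f g} => Monad.Algebra.Hom.ext ((shiftFunctor C n).map_add (f := f.f) (g := g.f))⟩
  let : Pretriangulated T.Algebra := hσ.homRetraction.pretriangulated hσ.exists_cone
  have : T.forget.IsTriangulated := ⟨fun _ h => h⟩
  have := Monad.commShift_freeCompForget_hom T
  refine ⟨inferInstance, inferInstance, inferInstance, inferInstance,
    HasHomotopyCartesianSquares.isTriangulated hσ.homRetraction.hasHomotopyCartesianSquares,
    inferInstance, inferInstance,
    ⟨fun Δ hΔ => ?_⟩, inferInstance, Monad.commShift_adj T, inferInstance⟩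
  -- The free functor is exact because its composite with the forgetful functor is the exact functor
  -- `M`.
  exact isomorphic_distinguished _ (T.toFunctor.map_distinguished Δ hΔ) _
    ((Functor.mapTriangleCompIso T.free T.forget).symm.app Δ ≪≫
      (Functor.mapTriangleIso T.freeCompForget).app Δ)
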